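/- Let $\log$ denote the natural logarithm. For a finite simple graph $G$, let $\Delta(G)$ be its maximum degree, let $\Delta_2(G)=\max_{x\neq y}|N(x)\cap N(y)|$ be its maximum codegree, where $x,y$ range over pairs of distinct vertices (with $\Delta_2(G)=0$ if $G$ has fewer than two vertices), and let $\alpha(G)$ be the size of a largest independent set of $G$. Theorem. There is a function $e:\mathbb{R}\to\mathbb{R}$ with $e(\Delta)\to 0$ as $\Delta\to\infty$ such that the following holds for every real number $\Delta>1$ and every $n$. If $G$ is an $n$-vertex graph with \[ \Delta(G)\le\Delta \qquad\text{and}\qquad \Delta_2(G)\le 2^{-7}\,\Delta\,(\log\Delta)^{-7}, \] then \[ \alpha(G)\ \ge\ \bigl(1-e(\Delta)\bigr)\,\frac{n\log\Delta}{\Delta}. \] -/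

import Mathlib

open Filter Topology

/-- The maximum codegree of a finite graph: the largest number of common neighbours
of two distinct vertices (and `0` if there are no two distinct vertices). -/
def SimpleGraph.maxCodegree {V : Type*} [Fintype V] [DecidableEq V]
    (G : SimpleGraph V) [DecidableRel G.Adj] : ℕ :=
  (Finset.univ : Finset V).offDiag.sup fun p =>
    (G.neighborFinset p.1 ∩ G.neighborFinset p.2).card

/-! The proof is a Rödl nibble. While the current vertex set `S` has degrees at most `D` and
codegrees at most `κ * D`, choose vertices independently with probability about `γ / D`. Chosen
vertices without chosen neighbours, about `γ * |S| / D` of them, join the independent set; the next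
set consists of unchosen vertices without chosen neighbours. Vertex count and degree bound both
shrink by a factor `1 - γ + O(γ ^ 2)`, so `|S| / D` stays near `n / Δ`, and about `log Δ / γ` steps
fit before the degree bound becomes too small. The total gain is about `n * log Δ / Δ`.

Small codegree makes degrees shrink uniformly: one chosen vertex kills few pairs of neighbours of
`v` at once, so an exponential moment bound (`bernExp_missed_gt_le`, `nibble_tail`) shows that
failures have probability at most `exp (-γ ^ 3 / (6 * κ))`. Vertices where the degree or a codegree
fails are discarded, at an expected cost of `O(γ ^ 2)` per vertex. Dummy neighbours give all
vertices the same number `d` of potential killers, hence the same chance of being hit.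
`exists_nibble` is one step, `exists_indepSet_of_iterate` the induction, and
`indepNumBound_of_large` chooses the parameters. -/

/-- The expectation of `f A` where `A` contains each element of `J` independently with
probability `p`. -/
noncomputable def bernExp {ι : Type*} [DecidableEq ι] (p : ℝ) (J : Finset ι)
    (f : Finset ι → ℝ) : ℝ :=
  ∑ A ∈ J.powerset, p ^ A.card * (1 - p) ^ (J \ A).card * f A

/-! ### Expectations over independent random subsets. -/

section bernExp

variable {ι : Type*} [DecidableEq ι] {p : ℝ} {J : Finset ι}

lemma bernExp_empty (f : Finset ι → ℝ) : bernExp p ∅ f = f ∅ := by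
  simp [bernExp]

/-- Conditioning on whether `i` is chosen; this drives the inductions on `J`. -/
lemma bernExp_insert {i : ι} (hi : i ∉ J) (f : Finset ι → ℝ) :
    bernExp p (insert i J) f =
      (1 - p) * bernExp p J f + p * bernExp p J (fun A => f (insert i A)) := by
  unfold bernExp
  rw [Finset.sum_powerset_insert hi, Finset.mul_sum, Finset.mul_sum]
  congr 1
  · refine Finset.sum_congr rfl fun A hA => ?_
    have hiA : i ∉ A := fun h => hi (Finset.mem_powerset.1 hA h)
    rw [Finset.insert_sdiff_of_notMem _ hiA, Finset.card_insert_of_notMem (by simp [hi])]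
    ring
  · refine Finset.sum_congr rfl fun A hA => ?_
    have hiA : i ∉ A := fun h => hi (Finset.mem_powerset.1 hA h)
    rw [Finset.insert_sdiff_insert, Finset.sdiff_insert_of_notMem hi,
      Finset.card_insert_of_notMem hiA]
    ring

lemma bernExp_add (f g : Finset ι → ℝ) :
    bernExp p J (fun A => f A + g A) = bernExp p J f + bernExp p J g := by
  simp only [bernExp, mul_add, Finset.sum_add_distrib]

lemma bernExp_sub (f g : Finset ι → ℝ) :
    bernExp p J (fun A => f A - g A) = bernExp p J f - bernExp p J g := by
  simp only [bernExp, mul_sub, Finset.sum_sub_distrib]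

lemma bernExp_const_mul (c : ℝ) (f : Finset ι → ℝ) :
    bernExp p J (fun A => c * f A) = c * bernExp p J f := by
  simp only [bernExp, Finset.mul_sum]
  exact Finset.sum_congr rfl fun A _ => by ring

lemma bernExp_sum {κ : Type*} (s : Finset κ) (f : κ → Finset ι → ℝ) :
    bernExp p J (fun A => ∑ k ∈ s, f k A) = ∑ k ∈ s, bernExp p J (f k) := by
  simp only [bernExp, Finset.mul_sum]
  exact Finset.sum_comm

lemma bernExp_mono (hp : 0 ≤ p) (hp1 : p ≤ 1) {f g : Finset ι → ℝ} (h : ∀ A ⊆ J, f A ≤ g A) :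
    bernExp p J f ≤ bernExp p J g := by
  have : 0 ≤ 1 - p := by linarith
  exact Finset.sum_le_sum fun A hA =>
    mul_le_mul_of_nonneg_left (h A (Finset.mem_powerset.1 hA)) (by positivity)

lemma bernExp_const (c : ℝ) : bernExp p J (fun _ => c) = c := by
  induction J using Finset.induction_on with
  | empty => exact bernExp_empty _
  | insert i J hi ih => rw [bernExp_insert hi, ih]; ring

lemma exists_bernExp_le (hp : 0 ≤ p) (hp1 : p ≤ 1) (f : Finset ι → ℝ) :
    ∃ A ⊆ J, bernExp p J f ≤ f A := by
  obtain ⟨A, hA, hmax⟩ := J.powerset.exists_max_image f ⟨∅, Finset.empty_mem_powerset J⟩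
  refine ⟨A, Finset.mem_powerset.1 hA, ?_⟩
  calc bernExp p J f ≤ bernExp p J (fun _ => f A) :=
        bernExp_mono hp hp1 fun B hB => hmax B (Finset.mem_powerset.2 hB)
    _ = f A := bernExp_const _

lemma bernExp_disjoint (e : Finset ι) :
    bernExp p J (fun A => if Disjoint e A then 1 else 0) = (1 - p) ^ (e ∩ J).card := by
  induction J using Finset.induction_on with
  | empty => simp [bernExp_empty]
  | insert i J hi ih =>
    rw [bernExp_insert hi, ih]
    by_cases hie : i ∈ e
    · have h0 : bernExp p J (fun A => if Disjoint e (insert i A) then (1 : ℝ) else 0) = 0 := by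
        simp [Finset.disjoint_insert_right, hie, bernExp_const]
      rw [h0, Finset.inter_insert_of_mem hie, Finset.card_insert_of_notMem (by simp [hi])]
      ring
    · have h0 : bernExp p J (fun A => if Disjoint e (insert i A) then (1 : ℝ) else 0)
          = (1 - p) ^ (e ∩ J).card := by
        rw [← ih]
        simp [Finset.disjoint_insert_right, hie]
      rw [h0, Finset.inter_insert_of_notMem hie]
      ring

/-! ### Exponential moments and the upper tail. -/

lemma Real.exp_neg_le_quadratic {x : ℝ} (hx : 0 ≤ x) : Real.exp (-x) ≤ 1 - x + x ^ 2 / 2 := by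
  have h := Real.quadratic_le_exp_of_nonneg hx
  have hpos : 0 < 1 + x + x ^ 2 / 2 := by positivity
  rw [Real.exp_neg]
  calc (Real.exp x)⁻¹ ≤ (1 + x + x ^ 2 / 2)⁻¹ := inv_anti₀ hpos h
    _ ≤ 1 - x + x ^ 2 / 2 := by
      rw [inv_le_iff_one_le_mul₀ hpos]
      -- The product of the two quadratics is `1 + x ^ 4 / 4`.
      nlinarith [sq_nonneg (x ^ 2)]

lemma bernoulli_exp_neg_le {p x : ℝ} (hp : 0 ≤ p) (hx : 0 ≤ x) :
    1 - p + p * Real.exp (-x) ≤ Real.exp (-(p * x) + p * x ^ 2 / 2) := by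
  have h1 := Real.exp_neg_le_quadratic hx
  have h2 := Real.add_one_le_exp (-(p * x) + p * x ^ 2 / 2)
  nlinarith

/-- Exponential moment bound for the weighted number of sets `e w` missed by a random set. -/
lemma bernExp_exp_weighted_le {κ : Type*} (hp : 0 ≤ p) (hp1 : p ≤ 1) {t : ℝ} (ht : 0 ≤ t)
    (W : Finset κ) (e : κ → Finset ι) (c : κ → ℝ) (hc : ∀ w, 0 ≤ c w) :
    bernExp p J (fun A => Real.exp (t * ∑ w ∈ W, c w * if Disjoint (e w) A then 1 else 0)) ≤
      Real.exp (t * ∑ w ∈ W, c w * (1 - p) ^ (e w ∩ J).card +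
        p * t ^ 2 / 2 * ∑ i ∈ J, (∑ w ∈ W, if i ∈ e w then c w else 0) ^ 2) := by
  have hq : 0 ≤ 1 - p := by linarith
  induction J using Finset.induction_on generalizing c with
  | empty => simp [bernExp_empty]
  | insert i J hi ih =>
    rw [bernExp_insert hi]
    -- Choosing `i` kills exactly the sets containing `i`, which amounts to giving them weight zero.
    -- General weights keep the induction closed under this.
    set c' : κ → ℝ := fun w => if i ∈ e w then 0 else c w with hc'
    have hc'0 : ∀ w, 0 ≤ c' w := fun w => by
      simp only [hc']; split_ifs
      · exact le_rfl
      · exact hc w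
    have hc'le : ∀ w, c' w ≤ c w := fun w => by
      simp only [hc']; split_ifs
      · exact hc w
      · exact le_rfl
    have h1 := ih c hc
    have h2 := ih c' hc'0
    have hf : ∀ A : Finset ι,
        Real.exp (t * ∑ w ∈ W, c w * if Disjoint (e w) (insert i A) then 1 else 0)
          = Real.exp (t * ∑ w ∈ W, c' w * if Disjoint (e w) A then 1 else 0) := by
      intro A
      congr 2
      refine Finset.sum_congr rfl fun w _ => ?_
      by_cases hw : i ∈ e w <;> simp [hc', hw, Finset.disjoint_insert_right]
    simp only [hf]
    set m := ∑ w ∈ W, c w * (1 - p) ^ (e w ∩ J).card with hm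
    set s := ∑ w ∈ W, (if i ∈ e w then c w else 0) * (1 - p) ^ (e w ∩ J).card with hs
    set k := ∑ w ∈ W, (if i ∈ e w then c w else 0) with hk
    set Q := ∑ j ∈ J, (∑ w ∈ W, if j ∈ e w then c w else 0) ^ 2 with hQ
    have hm' : ∑ w ∈ W, c' w * (1 - p) ^ (e w ∩ J).card = m - s := by
      rw [hm, hs, ← Finset.sum_sub_distrib]
      refine Finset.sum_congr rfl fun w _ => ?_
      by_cases hw : i ∈ e w <;> simp [hc', hw]
    have hQ' : ∑ j ∈ J, (∑ w ∈ W, if j ∈ e w then c' w else 0) ^ 2 ≤ Q := by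
      refine Finset.sum_le_sum fun j _ => ?_
      refine pow_le_pow_left₀ (Finset.sum_nonneg fun w _ => ?_)
        (Finset.sum_le_sum fun w _ => ?_) 2
      · split_ifs
        · exact hc'0 w
        · exact le_rfl
      · split_ifs
        · exact hc'le w
        · exact le_rfl
    have hmi : ∑ w ∈ W, c w * (1 - p) ^ (e w ∩ insert i J).card = m - p * s := by
      rw [hm, hs, Finset.mul_sum, ← Finset.sum_sub_distrib]
      refine Finset.sum_congr rfl fun w _ => ?_
      by_cases hw : i ∈ e w
      · rw [Finset.inter_insert_of_mem hw, Finset.card_insert_of_notMem (by simp [hi])]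
        simp only [hw, if_true]
        ring
      · rw [Finset.inter_insert_of_notMem hw]
        simp [hw]
    have hterm : ∀ w, 0 ≤ (if i ∈ e w then c w else 0) := fun w => by
      split_ifs
      · exact hc w
      · exact le_rfl
    have hs0 : 0 ≤ s := Finset.sum_nonneg fun w _ => mul_nonneg (hterm w) (by positivity)
    have hsk : s ≤ k := Finset.sum_le_sum fun w _ =>
      mul_le_of_le_one_right (hterm w) (pow_le_one₀ hq (by linarith))
    rw [hm'] at h2
    rw [hmi, Finset.sum_insert hi]
    have h2' : bernExp p J
        (fun A => Real.exp (t * ∑ w ∈ W, c' w * if Disjoint (e w) A then 1 else 0)) ≤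
        Real.exp (t * m + p * t ^ 2 / 2 * Q) * Real.exp (-(t * s)) := by
      rw [← Real.exp_add]
      refine h2.trans (Real.exp_le_exp.2 ?_)
      have : p * t ^ 2 / 2 * ∑ j ∈ J, (∑ w ∈ W, if j ∈ e w then c' w else 0) ^ 2 ≤
        p * t ^ 2 / 2 * Q := mul_le_mul_of_nonneg_left hQ' (by positivity)
      linarith
    have hB := bernoulli_exp_neg_le hp (mul_nonneg ht hs0)
    calc _ ≤ (1 - p) * Real.exp (t * m + p * t ^ 2 / 2 * Q) +
          p * (Real.exp (t * m + p * t ^ 2 / 2 * Q) * Real.exp (-(t * s))) :=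
          add_le_add (mul_le_mul_of_nonneg_left h1 hq) (mul_le_mul_of_nonneg_left h2' hp)
      _ = Real.exp (t * m + p * t ^ 2 / 2 * Q) * (1 - p + p * Real.exp (-(t * s))) := by ring
      _ ≤ Real.exp (t * m + p * t ^ 2 / 2 * Q) *
          Real.exp (-(p * (t * s)) + p * (t * s) ^ 2 / 2) :=
          mul_le_mul_of_nonneg_left hB (Real.exp_pos _).le
      _ = Real.exp (t * m + p * t ^ 2 / 2 * Q + (-(p * (t * s)) + p * (t * s) ^ 2 / 2)) :=
          (Real.exp_add _ _).symm
      _ ≤ _ := by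
        refine Real.exp_le_exp.2 ?_
        have h3 : s ^ 2 ≤ k ^ 2 := pow_le_pow_left₀ hs0 hsk 2
        have h4 : p * t ^ 2 / 2 * s ^ 2 ≤ p * t ^ 2 / 2 * k ^ 2 :=
          mul_le_mul_of_nonneg_left h3 (by positivity)
        nlinarith

/-- Upper tail bound for the number of sets `e w` missed by a random set, when these sets have
size `d` and pairwise intersections of size at most `c`. -/
lemma bernExp_missed_gt_le {κ : Type*} [DecidableEq κ] (hp : 0 ≤ p) (hp1 : p ≤ 1) {t : ℝ}
    (ht : 0 ≤ t) (W : Finset κ) (e : κ → Finset ι) {d : ℕ} {c M a : ℝ} (hc : 0 ≤ c)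
    (heJ : ∀ w ∈ W, e w ⊆ J) (hd : ∀ w ∈ W, (e w).card = d)
    (hcod : ∀ w ∈ W, ∀ w' ∈ W, w ≠ w' → ((e w ∩ e w').card : ℝ) ≤ c)
    (hM : (W.card : ℝ) ≤ M) :
    bernExp p J (fun A => if a < ((W.filter fun w => Disjoint (e w) A).card : ℝ) then 1 else 0) ≤
      Real.exp (t * (M * (1 - p) ^ d - a) + p * t ^ 2 / 2 * (M * d + M ^ 2 * c)) := by
  have hq : 0 ≤ 1 - p := by linarith
  have hcount : ∀ A : Finset ι, ((W.filter fun w => Disjoint (e w) A).card : ℝ) =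
      ∑ w ∈ W, (1 : ℝ) * if Disjoint (e w) A then 1 else 0 := by
    intro A; simp
  have hmark : bernExp p J
      (fun A => if a < ((W.filter fun w => Disjoint (e w) A).card : ℝ) then 1 else 0) ≤
      Real.exp (-(t * a)) * bernExp p J
        (fun A => Real.exp (t * ∑ w ∈ W, (1 : ℝ) * if Disjoint (e w) A then 1 else 0)) := by
    rw [← bernExp_const_mul]
    refine bernExp_mono hp hp1 fun A _ => ?_
    rw [← hcount, ← Real.exp_add]
    split_ifs with h
    · refine Real.one_le_exp ?_
      have := mul_le_mul_of_nonneg_left h.le ht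
      linarith
    · exact (Real.exp_pos _).le
  have hexp := bernExp_exp_weighted_le (J := J) hp hp1 ht W e (fun _ => 1) fun _ => zero_le_one
  have hmean : ∑ w ∈ W, (1 : ℝ) * (1 - p) ^ (e w ∩ J).card ≤ M * (1 - p) ^ d := by
    have : ∑ w ∈ W, (1 : ℝ) * (1 - p) ^ (e w ∩ J).card = W.card * (1 - p) ^ d := by
      rw [← nsmul_eq_mul]
      refine Finset.sum_eq_card_nsmul fun w hw => ?_
      rw [Finset.inter_eq_left.2 (heJ w hw), hd w hw, one_mul]
    rw [this]
    exact mul_le_mul_of_nonneg_right hM (by positivity)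
  -- Double counting: the sum of squared degrees is the sum of `|e w ∩ e w'|` over ordered pairs.
  -- The diagonal contributes `M * d`, the rest at most `M ^ 2 * c`.
  have hsq : ∑ i ∈ J, (∑ w ∈ W, if i ∈ e w then (1 : ℝ) else 0) ^ 2 ≤ M * d + M ^ 2 * c := by
    have h1 : ∑ i ∈ J, (∑ w ∈ W, if i ∈ e w then (1 : ℝ) else 0) ^ 2 =
        ∑ w ∈ W, ∑ w' ∈ W, ((e w ∩ e w').card : ℝ) := by
      simp_rw [sq, Finset.sum_mul_sum]
      rw [Finset.sum_comm]
      refine Finset.sum_congr rfl fun w hw => ?_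
      rw [Finset.sum_comm]
      refine Finset.sum_congr rfl fun w' _ => ?_
      have : e w ∩ e w' = J.filter fun i => i ∈ e w ∧ i ∈ e w' := by
        ext i
        simp only [Finset.mem_inter, Finset.mem_filter]
        exact ⟨fun h => ⟨heJ w hw h.1, h⟩, fun h => h.2⟩
      rw [this, Finset.card_filter]
      push_cast
      refine Finset.sum_congr rfl fun i _ => ?_
      by_cases h : i ∈ e w <;> by_cases h' : i ∈ e w' <;> simp [h, h']
    rw [h1]
    have h2 : ∀ w ∈ W, ∑ w' ∈ W, ((e w ∩ e w').card : ℝ) ≤ d + M * c := by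
      intro w hw
      rw [← Finset.add_sum_erase W _ hw, Finset.inter_self, hd w hw]
      have : ∑ w' ∈ W.erase w, ((e w ∩ e w').card : ℝ) ≤ (W.erase w).card • c :=
        Finset.sum_le_card_nsmul _ _ _ fun w' hw' =>
          hcod w hw w' (Finset.mem_of_mem_erase hw') (Finset.ne_of_mem_erase hw').symm
      rw [nsmul_eq_mul] at this
      have h3 : ((W.erase w).card : ℝ) ≤ M :=
        le_trans (by exact_mod_cast Finset.card_le_card (Finset.erase_subset w W)) hM
      have := mul_le_mul_of_nonneg_right h3 hc
      linarith
    have h3 := Finset.sum_le_card_nsmul _ _ _ h2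
    rw [nsmul_eq_mul] at h3
    have hM0 : 0 ≤ M := le_trans (Nat.cast_nonneg _) hM
    calc _ ≤ _ := h3
      _ ≤ M * (d + M * c) := mul_le_mul_of_nonneg_right hM (by positivity)
      _ = _ := by ring
  calc _ ≤ _ := hmark
    _ ≤ Real.exp (-(t * a)) * _ := mul_le_mul_of_nonneg_left hexp (Real.exp_pos _).le
    _ = _ := (Real.exp_add _ _).symm
    _ ≤ _ := by
      refine Real.exp_le_exp.2 ?_
      have h1 := mul_le_mul_of_nonneg_left hmean ht
      have h2 := mul_le_mul_of_nonneg_left hsq (by positivity : 0 ≤ p * t ^ 2 / 2)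
      linarith

end bernExp

/-! ### One nibble step. -/

section nibble

variable {V : Type*} [Fintype V] [DecidableEq V] (G : SimpleGraph V) [DecidableRel G.Adj]

/-- The neighbours of `v` in `S`, together with dummy elements that bring their number up to `d`. -/
def SimpleGraph.paddedNeighbors (S : Finset V) (d : ℕ) (v : V) : Finset (V ⊕ (V × ℕ)) :=
  (G.neighborFinset v ∩ S).disjSum
    ({v} ×ˢ Finset.range (d - (G.neighborFinset v ∩ S).card))

lemma SimpleGraph.inl_mem_paddedNeighbors {S : Finset V} {d : ℕ} {v w : V} :
    Sum.inl w ∈ G.paddedNeighbors S d v ↔ G.Adj v w ∧ w ∈ S := by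
  simp [SimpleGraph.paddedNeighbors]

lemma SimpleGraph.paddedNeighbors_subset {S : Finset V} {d : ℕ} {v : V} (hv : v ∈ S) :
    G.paddedNeighbors S d v ⊆ S.disjSum (S ×ˢ Finset.range d) := by
  refine Finset.disjSum_mono Finset.inter_subset_right ?_
  exact Finset.product_subset_product (by simpa using hv)
    (Finset.range_subset_range.2 (Nat.sub_le _ _))

lemma SimpleGraph.card_paddedNeighbors {S : Finset V} {d : ℕ} {v : V}
    (hd : (G.neighborFinset v ∩ S).card ≤ d) : (G.paddedNeighbors S d v).card = d := by
  rw [SimpleGraph.paddedNeighbors, Finset.card_disjSum, Finset.card_product]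
  simp only [Finset.card_singleton, Finset.card_range]
  omega

/-- Dummies carry the name of their vertex, so padding creates no new common elements. -/
lemma SimpleGraph.card_paddedNeighbors_inter {S : Finset V} {d : ℕ} {u v : V} (huv : u ≠ v) :
    (G.paddedNeighbors S d u ∩ G.paddedNeighbors S d v).card =
      (G.neighborFinset u ∩ G.neighborFinset v ∩ S).card := by
  have : G.paddedNeighbors S d u ∩ G.paddedNeighbors S d v =
      (G.neighborFinset u ∩ G.neighborFinset v ∩ S).disjSum ∅ := by
    ext (w | ⟨w, j⟩)
    · simp [SimpleGraph.paddedNeighbors]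
      tauto
    · simp only [SimpleGraph.paddedNeighbors, Finset.mem_inter, Finset.inr_mem_disjSum,
        Finset.mem_product, Finset.mem_singleton, Finset.notMem_empty, iff_false]
      rintro ⟨⟨h1, -⟩, h2, -⟩
      exact huv (h1.symm.trans h2)
  rw [this, Finset.card_disjSum, Finset.card_empty, add_zero]

/-- The vertices of `S` all of whose padded neighbours lie outside `R`. -/
def SimpleGraph.survivors (S : Finset V) (d : ℕ) (R : Finset (V ⊕ (V × ℕ))) : Finset V :=
  S.filter fun v => Disjoint (G.paddedNeighbors S d v) R

variable {G} {S : Finset V} {γ κ D : ℝ}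

/-- Used with `M = D` for degrees and `M = κ * D` for codegrees. The condition `1 ≤ κ * M` lets the
diagonal part of the variance be absorbed by the codegree part. -/
lemma nibble_tail (hγ : 0 < γ) (hγ1 : γ ≤ 1 / 2) (hκ : 0 < κ) {d : ℕ} (hd1 : 1 ≤ d)
    (hdD : D ≤ 2 * d) (hdeg : ∀ v ∈ S, (G.neighborFinset v ∩ S).card ≤ d)
    (hcod : ∀ u ∈ S, ∀ v ∈ S, u ≠ v →
      ((G.neighborFinset u ∩ G.neighborFinset v ∩ S).card : ℝ) ≤ κ * D)
    (hD : 0 ≤ D) {W : Finset V} (hW : W ⊆ S) {M : ℝ} (hWM : (W.card : ℝ) ≤ M)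
    (hM : 1 ≤ κ * M) :
    bernExp (γ / d) (S.disjSum (S ×ˢ Finset.range d))
      (fun R => if (1 - γ + 2 * γ ^ 2) * M < ((W ∩ G.survivors S d R).card : ℝ) then 1 else 0) ≤
      Real.exp (-(γ ^ 3 / (6 * κ))) := by
  have hd0 : (1 : ℝ) ≤ d := by exact_mod_cast hd1
  have hdpos : (0 : ℝ) < d := by linarith
  have hMpos : 0 < M := by
    by_contra h
    nlinarith
  have hp : 0 ≤ γ / d := by positivity
  have hp1 : γ / d ≤ 1 := by
    rw [div_le_one hdpos]; linarith
  -- This minimises the exponent `-t * γ ^ 2 * M + 3 * γ * κ * M ^ 2 * t ^ 2 / 2` obtained below.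
  set t : ℝ := γ / (3 * κ * M) with ht
  have ht0 : 0 ≤ t := by positivity
  have key := bernExp_missed_gt_le (J := S.disjSum (S ×ˢ Finset.range d)) hp hp1 ht0 W
    (G.paddedNeighbors S d) (d := d) (c := κ * D) (M := M) (a := (1 - γ + 2 * γ ^ 2) * M)
    (by positivity) (fun w hw => G.paddedNeighbors_subset (hW hw))
    (fun w hw => G.card_paddedNeighbors (hdeg w (hW hw)))
    (fun w hw w' hw' hne => by
      rw [G.card_paddedNeighbors_inter hne]
      exact hcod w (hW hw) w' (hW hw') hne) hWM
  have hWs : ∀ R, W ∩ G.survivors S d R =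
      W.filter fun w => Disjoint (G.paddedNeighbors S d w) R := by
    intro R
    ext w
    simp only [SimpleGraph.survivors, Finset.mem_inter, Finset.mem_filter]
    exact ⟨fun h => ⟨h.1, h.2.2⟩, fun h => ⟨h.1, hW h.1, h.2⟩⟩
  simp only [hWs]
  refine key.trans (Real.exp_le_exp.2 ?_)
  have hpow : (1 - γ / d) ^ d ≤ 1 - γ + γ ^ 2 / 2 := by
    have h1 := Real.one_sub_div_pow_le_exp_neg (n := d) (t := γ) (by linarith)
    exact h1.trans (Real.exp_neg_le_quadratic hγ.le)
  have hmean : t * (M * (1 - γ / d) ^ d - (1 - γ + 2 * γ ^ 2) * M) ≤ t * (-(γ ^ 2 * M)) := by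
    refine mul_le_mul_of_nonneg_left ?_ ht0
    have := mul_le_mul_of_nonneg_left hpow hMpos.le
    have : 0 ≤ γ ^ 2 * M := by positivity
    nlinarith
  have hvar : γ / d * t ^ 2 / 2 * (M * d + M ^ 2 * (κ * D)) ≤ γ * t ^ 2 / 2 * (3 * κ * M ^ 2) := by
    have h1 : M * d + M ^ 2 * (κ * D) ≤ d * (3 * κ * M ^ 2) := by
      have ha : M * d * 1 ≤ M * d * (κ * M) := mul_le_mul_of_nonneg_left hM (by positivity)
      have hb : M ^ 2 * κ * D ≤ M ^ 2 * κ * (2 * d) :=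
        mul_le_mul_of_nonneg_left hdD (by positivity)
      linarith
    calc _ ≤ γ / d * t ^ 2 / 2 * (d * (3 * κ * M ^ 2)) :=
          mul_le_mul_of_nonneg_left h1 (by positivity)
      _ = _ := by field_simp
  have hfin : t * (-(γ ^ 2 * M)) + γ * t ^ 2 / 2 * (3 * κ * M ^ 2) = -(γ ^ 3 / (6 * κ)) := by
    rw [ht]; field_simp; ring
  linarith

/-- One step of the nibble. -/
lemma exists_nibble (hγ : 0 < γ) (hγ1 : γ ≤ 1 / 2) (hκ : 0 < κ) (hκ1 : κ ≤ 1)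
    (hκD : 1 ≤ κ * (κ * D)) (hγD : 2 ≤ γ * (D - 1))
    (hbad : (1 + D ^ 2) * Real.exp (-(γ ^ 3 / (6 * κ))) ≤ γ ^ 2)
    (hdeg : ∀ v ∈ S, ((G.neighborFinset v ∩ S).card : ℝ) ≤ D)
    (hcod : ∀ u ∈ S, ∀ v ∈ S, u ≠ v →
      ((G.neighborFinset u ∩ G.neighborFinset v ∩ S).card : ℝ) ≤ κ * D)
    {β : ℝ} (hβ : 0 ≤ β) :
    ∃ A ⊆ S, ∃ T ⊆ S, Disjoint A T ∧ (∀ a ∈ A, ∀ b ∈ A ∪ T, ¬ G.Adj a b) ∧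
      (∀ v ∈ T, ((G.neighborFinset v ∩ T).card : ℝ) ≤ (1 - γ + 2 * γ ^ 2) * D) ∧
      (∀ u ∈ T, ∀ v ∈ T, u ≠ v →
        ((G.neighborFinset u ∩ G.neighborFinset v ∩ T).card : ℝ) ≤
          κ * ((1 - γ + 2 * γ ^ 2) * D)) ∧
      (S.card : ℝ) * (γ * (1 - γ) / D + β * (1 - γ - 2 * γ ^ 2)) ≤ A.card + β * T.card := by
  classical
  have hD1 : 5 ≤ D := by nlinarith
  have hD0 : 0 < D := by linarith
  have hρ : 0 ≤ 1 - γ + 2 * γ ^ 2 := by nlinarith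
  set d : ℕ := ⌊D⌋₊ with hd
  have hdD : (d : ℝ) ≤ D := Nat.floor_le hD0.le
  have hDd : D < d + 1 := Nat.lt_floor_add_one D
  have hd4 : (4 : ℝ) ≤ d := by linarith
  have hd1 : 1 ≤ d := by
    have : (1 : ℝ) ≤ d := by linarith
    exact_mod_cast this
  have hdpos : (0 : ℝ) < d := by linarith
  have hdegN : ∀ v ∈ S, (G.neighborFinset v ∩ S).card ≤ d := fun v hv => Nat.le_floor (hdeg v hv)
  set p : ℝ := γ / d with hp
  have hpd : p * d = γ := by rw [hp]; field_simp
  have hp0 : 0 ≤ p := by positivity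
  have hpγ : p ≤ γ ^ 2 / 2 := by
    rw [hp, div_le_iff₀ hdpos]
    nlinarith
  have hp1 : p ≤ 1 := by nlinarith
  have hq : 0 ≤ 1 - p := by linarith
  set J : Finset (V ⊕ (V × ℕ)) := S.disjSum (S ×ˢ Finset.range d) with hJ
  set e := G.paddedNeighbors S d with he
  let A : Finset (V ⊕ (V × ℕ)) → Finset V := fun R =>
    S.filter fun v => Sum.inl v ∈ R ∧ ∀ w ∈ S, G.Adj v w → Sum.inl w ∉ R
  let badDeg : V → Finset (V ⊕ (V × ℕ)) → Prop := fun v R =>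
    (1 - γ + 2 * γ ^ 2) * D < (((G.neighborFinset v ∩ S) ∩ G.survivors S d R).card : ℝ)
  let badCod : V → V → Finset (V ⊕ (V × ℕ)) → Prop := fun v u R =>
    (1 - γ + 2 * γ ^ 2) * (κ * D) <
      (((G.neighborFinset v ∩ G.neighborFinset u ∩ S) ∩ G.survivors S d R).card : ℝ)
  -- Only vertices sharing a neighbour with `v` can have positive codegree with it, so the union
  -- bound has at most `D ^ 2` codegree events, independently of `|S|`.
  let N2 : V → Finset V := fun v =>
    (((G.neighborFinset v ∩ S).biUnion fun w => G.neighborFinset w ∩ S)).erase v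
  let T : Finset (V ⊕ (V × ℕ)) → Finset V := fun R =>
    S.filter fun v => Disjoint (insert (Sum.inl v) (e v)) R ∧
      ¬ badDeg v R ∧ ∀ u ∈ N2 v, ¬ badCod v u R
  have hN2 : ∀ v ∈ S, ((N2 v).card : ℝ) ≤ D ^ 2 := by
    intro v hv
    have h1 : (N2 v).card ≤ ∑ w ∈ G.neighborFinset v ∩ S, (G.neighborFinset w ∩ S).card :=
      (Finset.card_le_card (Finset.erase_subset _ _)).trans Finset.card_biUnion_le
    have h2 : ∑ w ∈ G.neighborFinset v ∩ S, (G.neighborFinset w ∩ S).card ≤ d * d := by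
      refine (Finset.sum_le_card_nsmul _ _ d fun w hw =>
        hdegN w (Finset.mem_inter.1 hw).2).trans ?_
      rw [smul_eq_mul]
      exact Nat.mul_le_mul_right _ (hdegN v hv)
    have h3 : ((N2 v).card : ℝ) ≤ d * d := by exact_mod_cast h1.trans h2
    nlinarith
  set q : ℝ := Real.exp (-(γ ^ 3 / (6 * κ))) with hqdef
  have hDc : D ≤ 2 * d := by linarith
  have hbadDeg : ∀ v ∈ S, bernExp p J (fun R => if badDeg v R then 1 else 0) ≤ q := by
    intro v hv
    refine nibble_tail hγ hγ1 hκ hd1 hDc hdegN hcod hD0.le Finset.inter_subset_right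
      (hdeg v hv) (hκD.trans ?_)
    exact mul_le_mul_of_nonneg_left (mul_le_of_le_one_left hD0.le hκ1) hκ.le
  have hbadCod : ∀ v ∈ S, ∀ u ∈ N2 v, bernExp p J (fun R => if badCod v u R then 1 else 0) ≤ q := by
    intro v hv u hu
    simp only [N2, Finset.mem_erase, Finset.mem_biUnion, Finset.mem_inter] at hu
    obtain ⟨huv, w, -, -, huS⟩ := hu
    exact nibble_tail hγ hγ1 hκ hd1 hDc hdegN hcod hD0.le Finset.inter_subset_right
      (hcod v hv u huS huv.symm) hκD
  have heJ : ∀ v ∈ S, e v ⊆ J := fun v hv => G.paddedNeighbors_subset hv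
  have hecard : ∀ v ∈ S, (e v).card = d := fun v hv => G.card_paddedNeighbors (hdegN v hv)
  have hinl : ∀ v, Sum.inl v ∉ e v := fun v h =>
    G.loopless.irrefl v (G.inl_mem_paddedNeighbors.1 h).1
  have hdisj1 : ∀ v ∈ S, bernExp p J
      (fun R => if Disjoint (e v) R then 1 else 0) = (1 - p) ^ d := by
    intro v hv
    rw [bernExp_disjoint, Finset.inter_eq_left.2 (heJ v hv), hecard v hv]
  have hdisj2 : ∀ v ∈ S, bernExp p J
      (fun R => if Disjoint (insert (Sum.inl v) (e v)) R then 1 else 0) = (1 - p) ^ (d + 1) := by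
    intro v hv
    have hsub : insert (Sum.inl v) (e v) ⊆ J := by
      refine Finset.insert_subset ?_ (heJ v hv)
      simpa [hJ] using hv
    rw [bernExp_disjoint, Finset.inter_eq_left.2 hsub, Finset.card_insert_of_notMem (hinl v),
      hecard v hv]
  have hpowd : 1 - γ ≤ (1 - p) ^ d := by
    have := one_add_mul_le_pow (a := -p) (by linarith) d
    rw [← sub_eq_add_neg] at this
    nlinarith
  have hpowd1 : 1 - γ - γ ^ 2 / 2 ≤ (1 - p) ^ (d + 1) := by
    have := one_add_mul_le_pow (a := -p) (by linarith) (d + 1)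
    rw [← sub_eq_add_neg] at this
    push_cast at this
    linarith
  have hA : (S.card : ℝ) * (γ * (1 - γ) / D) ≤ bernExp p J (fun R => ((A R).card : ℝ)) := by
    have h1 : ∀ v ∈ S, γ * (1 - γ) / D ≤ bernExp p J (fun R =>
        if Sum.inl v ∈ R ∧ ∀ w ∈ S, G.Adj v w → Sum.inl w ∉ R then 1 else 0) := by
      intro v hv
      -- Missing `e v` but not `insert v (e v)` means that `v` is chosen and no neighbour is.
      -- Padding makes this probability exactly `p * (1 - p) ^ d`.
      have h2 : bernExp p J (fun R => (if Disjoint (e v) R then (1 : ℝ) else 0) -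
            if Disjoint (insert (Sum.inl v) (e v)) R then 1 else 0) ≤
          bernExp p J (fun R =>
            if Sum.inl v ∈ R ∧ ∀ w ∈ S, G.Adj v w → Sum.inl w ∉ R then 1 else 0) := by
        refine bernExp_mono hp0 hp1 fun R _ => ?_
        by_cases h : Disjoint (e v) R
        · by_cases hvR : Sum.inl v ∈ R
          · have : Sum.inl v ∈ R ∧ ∀ w ∈ S, G.Adj v w → Sum.inl w ∉ R :=
              ⟨hvR, fun w hw hvw =>
                Finset.disjoint_left.1 h (G.inl_mem_paddedNeighbors.2 ⟨hvw, hw⟩)⟩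
            rw [if_pos this]
            split_ifs <;> norm_num
          · rw [if_pos h, if_pos (Finset.disjoint_insert_left.2 ⟨hvR, h⟩), sub_self]
            split_ifs <;> norm_num
        · rw [if_neg h]
          split_ifs <;> norm_num
      refine le_trans ?_ h2
      rw [bernExp_sub, hdisj1 v hv, hdisj2 v hv]
      have h3 : (1 - p) ^ d - (1 - p) ^ (d + 1) = p * (1 - p) ^ d := by ring
      rw [h3]
      calc γ * (1 - γ) / D ≤ γ * (1 - γ) / d :=
            div_le_div_of_nonneg_left (by nlinarith) hdpos hdD
        _ = p * (1 - γ) := by rw [hp]; ring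
        _ ≤ p * (1 - p) ^ d := mul_le_mul_of_nonneg_left hpowd hp0
    have h4 : ∀ R, ((A R).card : ℝ) = ∑ v ∈ S,
        if Sum.inl v ∈ R ∧ ∀ w ∈ S, G.Adj v w → Sum.inl w ∉ R then 1 else 0 := by
      intro R
      simp only [A, Finset.card_filter]
      push_cast
      rfl
    simp only [h4]
    rw [bernExp_sum, ← nsmul_eq_mul]
    exact Finset.card_nsmul_le_sum _ _ _ h1
  have hT : (S.card : ℝ) * (1 - γ - 2 * γ ^ 2) ≤ bernExp p J (fun R => ((T R).card : ℝ)) := by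
    have h1 : ∀ v ∈ S, 1 - γ - 2 * γ ^ 2 ≤ bernExp p J (fun R =>
        if Disjoint (insert (Sum.inl v) (e v)) R ∧
          ¬ badDeg v R ∧ ∀ u ∈ N2 v, ¬ badCod v u R then 1 else 0) := by
      intro v hv
      have h2 : bernExp p J (fun R =>
            (if Disjoint (insert (Sum.inl v) (e v)) R then (1 : ℝ) else 0) -
            ((if badDeg v R then 1 else 0) + ∑ u ∈ N2 v, if badCod v u R then 1 else 0)) ≤
          bernExp p J (fun R =>
            if Disjoint (insert (Sum.inl v) (e v)) R ∧
              ¬ badDeg v R ∧ ∀ u ∈ N2 v, ¬ badCod v u R then 1 else 0) := by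
        refine bernExp_mono hp0 hp1 fun R _ => ?_
        have hnn : ∀ u ∈ N2 v, (0 : ℝ) ≤ if badCod v u R then 1 else 0 := fun u _ => by
          split_ifs <;> norm_num
        have hs := Finset.sum_nonneg hnn
        have h01 : (0 : ℝ) ≤ if badDeg v R then 1 else 0 := by split_ifs <;> norm_num
        by_cases hv1 : Disjoint (insert (Sum.inl v) (e v)) R
        · by_cases hv2 : badDeg v R
          · rw [if_pos hv1, if_pos hv2]
            split_ifs <;> linarith
          · by_cases hv3 : ∀ u ∈ N2 v, ¬ badCod v u R
            · rw [if_pos hv1, if_pos (⟨hv1, hv2, hv3⟩ : _ ∧ _ ∧ _)]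
              linarith
            · push Not at hv3
              obtain ⟨u, hu, hbu⟩ := hv3
              have := Finset.single_le_sum hnn hu
              rw [if_pos hbu] at this
              rw [if_pos hv1]
              split_ifs <;> linarith
        · rw [if_neg hv1]
          split_ifs <;> linarith
      refine le_trans ?_ h2
      rw [bernExp_sub, bernExp_add, bernExp_sum, hdisj2 v hv]
      have h3 := Finset.sum_le_card_nsmul _ _ _ (hbadCod v hv)
      rw [nsmul_eq_mul] at h3
      have h4 := mul_le_mul_of_nonneg_right (hN2 v hv) (Real.exp_pos (-(γ ^ 3 / (6 * κ)))).le
      have h5 := hbadDeg v hv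
      rw [← hqdef] at h4
      nlinarith
    have h4 : ∀ R, ((T R).card : ℝ) = ∑ v ∈ S,
        if Disjoint (insert (Sum.inl v) (e v)) R ∧
          ¬ badDeg v R ∧ ∀ u ∈ N2 v, ¬ badCod v u R then 1 else 0 := by
      intro R
      simp only [T, Finset.card_filter]
      push_cast
      rfl
    simp only [h4]
    rw [bernExp_sum, ← nsmul_eq_mul]
    exact Finset.card_nsmul_le_sum _ _ _ h1
  -- A single outcome must serve both sizes, hence the weighted sum with `β`.
  obtain ⟨R, -, hR⟩ := exists_bernExp_le (J := J) hp0 hp1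
    (fun R => ((A R).card : ℝ) + β * (T R).card)
  rw [bernExp_add, bernExp_const_mul] at hR
  have hTsurv : T R ⊆ G.survivors S d R := by
    intro v hv
    simp only [T, Finset.mem_filter] at hv
    simp only [SimpleGraph.survivors, Finset.mem_filter]
    exact ⟨hv.1, (Finset.disjoint_insert_left.1 hv.2.1).2⟩
  have hTS : T R ⊆ S := Finset.filter_subset _ _
  have hmono : ∀ U : Finset V, ((U ∩ T R).card : ℝ) ≤ ((U ∩ S) ∩ G.survivors S d R).card := by
    intro U
    refine Nat.cast_le.2 (Finset.card_le_card fun v hv => ?_)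
    rw [Finset.mem_inter] at hv
    exact Finset.mem_inter.2 ⟨Finset.mem_inter.2 ⟨hv.1, hTS hv.2⟩, hTsurv hv.2⟩
  refine ⟨A R, Finset.filter_subset _ _, T R, hTS, ?_, ?_, ?_, ?_, ?_⟩
  · rw [Finset.disjoint_left]
    intro v hvA hvT
    simp only [A, T, Finset.mem_filter] at hvA hvT
    exact (Finset.disjoint_insert_left.1 hvT.2.1).1 hvA.2.1
  · intro a ha b hb hab
    simp only [A, Finset.mem_filter] at ha
    rcases Finset.mem_union.1 hb with hb | hb
    · simp only [A, Finset.mem_filter] at hb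
      exact ha.2.2 b hb.1 hab hb.2.1
    · have hb' := hTsurv hb
      simp only [SimpleGraph.survivors, Finset.mem_filter] at hb'
      exact Finset.disjoint_left.1 hb'.2
        (G.inl_mem_paddedNeighbors.2 ⟨hab.symm, ha.1⟩) ha.2.1
  · intro v hv
    refine (hmono _).trans ?_
    simp only [T, Finset.mem_filter] at hv
    exact not_lt.1 hv.2.2.1
  · intro u hu v hv huv
    by_cases hcn : (G.neighborFinset u ∩ G.neighborFinset v ∩ T R) = ∅
    · rw [hcn]
      simp only [Finset.card_empty, Nat.cast_zero]
      positivity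
    · obtain ⟨w, hw⟩ := Finset.nonempty_iff_ne_empty.2 hcn
      simp only [Finset.mem_inter, SimpleGraph.mem_neighborFinset] at hw
      have hvN : v ∈ N2 u := by
        simp only [N2, Finset.mem_erase, Finset.mem_biUnion, Finset.mem_inter,
          SimpleGraph.mem_neighborFinset]
        exact ⟨huv.symm, w, ⟨hw.1.1, hTS hw.2⟩, hw.1.2.symm, hTS hv⟩
      refine (hmono _).trans ?_
      simp only [T, Finset.mem_filter] at hu
      have := not_lt.1 (hu.2.2.2 v hvN)
      linarith
  · calc (S.card : ℝ) * (γ * (1 - γ) / D + β * (1 - γ - 2 * γ ^ 2))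
        = S.card * (γ * (1 - γ) / D) + β * (S.card * (1 - γ - 2 * γ ^ 2)) := by ring
      _ ≤ _ := add_le_add hA (mul_le_mul_of_nonneg_left hT hβ)
      _ ≤ _ := hR

/-! ### Iteration. -/

/-- Iterating the nibble. -/
lemma exists_indepSet_of_iterate (hγ : 0 < γ) (hγ1 : γ ≤ 1 / 4) (hκ : 0 < κ) (hκ1 : κ ≤ 1)
    {D₀ D₁ : ℝ} (hD₀ : 0 < D₀) (hκD : 1 ≤ κ * (κ * D₀)) (hγD : 2 ≤ γ * (D₀ - 1))
    (hbad : (1 + D₁ ^ 2) * Real.exp (-(γ ^ 3 / (6 * κ))) ≤ γ ^ 2) (K : ℕ) :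
    ∀ (D : ℝ) (S : Finset V), D₀ * Real.exp (γ * K) ≤ D → D ≤ D₁ →
      (∀ v ∈ S, ((G.neighborFinset v ∩ S).card : ℝ) ≤ D) →
      (∀ u ∈ S, ∀ v ∈ S, u ≠ v →
        ((G.neighborFinset u ∩ G.neighborFinset v ∩ S).card : ℝ) ≤ κ * D) →
      ∃ I ⊆ S, G.IsIndepSet (I : Set V) ∧
        K * (γ * (1 - γ)) * (1 - 8 * γ ^ 2) ^ K / D * S.card ≤ I.card := by
  induction K with
  | zero =>
    intro D S _ _ _ _
    exact ⟨∅, Finset.empty_subset _, by simp, by simp⟩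
  | succ K ih =>
    intro D S hD hDD hdeg hcod
    have hD₀D : D₀ ≤ D := by
      refine le_trans ?_ hD
      exact le_mul_of_one_le_right hD₀.le (Real.one_le_exp (by positivity))
    have hDpos : 0 < D := hD₀.trans_le hD₀D
    set ρ : ℝ := 1 - γ + 2 * γ ^ 2 with hρ
    have hρ0 : 1 / 2 ≤ ρ := by nlinarith
    have hρpos : 0 < ρ := by linarith
    have hρ1 : ρ ≤ 1 := by nlinarith
    have h8 : 0 ≤ 1 - 8 * γ ^ 2 := by nlinarith
    have h81 : 1 - 8 * γ ^ 2 ≤ 1 := by nlinarith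
    set b : ℝ := K * (γ * (1 - γ)) * (1 - 8 * γ ^ 2) ^ K with hb
    have hg0 : 0 ≤ γ * (1 - γ) := mul_nonneg hγ.le (by linarith)
    have hb0 : 0 ≤ b := by positivity
    -- The weight `β` is the yield per surviving vertex guaranteed by the remaining `K` steps at
    -- degree bound `ρ * D`.
    obtain ⟨A, hAS, T, hTS, hAT, hind, hTdeg, hTcod, hcard⟩ :=
      exists_nibble (G := G) (S := S) (D := D) hγ (by linarith) hκ hκ1
        (hκD.trans (by gcongr)) (hγD.trans (by gcongr))
        (le_trans (mul_le_mul_of_nonneg_right (by gcongr) (Real.exp_pos _).le) hbad)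
        hdeg hcod (β := b / (ρ * D)) (by positivity)
    -- The degree bound falls by at most a factor `exp (-γ)` per step, so it stays above `D₀`
    -- throughout.
    have hexp : Real.exp (-γ) ≤ ρ := by
      have := Real.exp_neg_le_quadratic hγ.le
      nlinarith
    obtain ⟨I, hIT, hI, hIcard⟩ := ih (ρ * D) T (by
        have h1 : D₀ * Real.exp (γ * K) = Real.exp (-γ) * (D₀ * Real.exp (γ * (K + 1 : ℕ))) := by
          rw [mul_left_comm, ← Real.exp_add]
          push_cast
          ring_nf
        rw [h1]
        exact mul_le_mul hexp hD (by positivity) hρpos.le)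
      ((mul_le_of_le_one_left hDpos.le hρ1).trans hDD) hTdeg hTcod
    refine ⟨A ∪ I, Finset.union_subset hAS (hIT.trans hTS), ?_, ?_⟩
    · intro x hx y hy hxy hadj
      simp only [Finset.coe_union, Set.mem_union, Finset.mem_coe] at hx hy
      rcases hx with hx | hx
      · exact hind x hx y (Finset.mem_union.2 (hy.imp id fun h => hIT h)) hadj
      · rcases hy with hy | hy
        · exact hind y hy x (Finset.mem_union.2 (Or.inr (hIT hx))) hadj.symm
        · exact hI hx hy hxy hadj
    · rw [Finset.card_union_of_disjoint (Finset.disjoint_of_subset_right hIT hAT)]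
      push_cast
      have h1 : ((K : ℝ) + 1) * (γ * (1 - γ)) * (1 - 8 * γ ^ 2) ^ (K + 1) ≤
          γ * (1 - γ) + b * (1 - 8 * γ ^ 2) := by
        have h2 : γ * (1 - γ) * (1 - 8 * γ ^ 2) ^ (K + 1) ≤ γ * (1 - γ) :=
          mul_le_of_le_one_right hg0 (pow_le_one₀ h8 h81)
        have h3 : b * (1 - 8 * γ ^ 2) = K * (γ * (1 - γ)) * (1 - 8 * γ ^ 2) ^ (K + 1) := by
          rw [hb]; ring
        rw [h3]
        linarith
      -- The vertex set shrinks faster than the degree bound by the ratio `(1 - γ - 2 * γ ^ 2) / ρ =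
      -- 1 - 4 * γ ^ 2 / ρ`, and `ρ ≥ 1 / 2`.
      have h4 : b * (1 - 8 * γ ^ 2) ≤ b / ρ * (1 - γ - 2 * γ ^ 2) := by
        rw [div_mul_eq_mul_div, mul_div_assoc]
        refine mul_le_mul_of_nonneg_left ?_ hb0
        rw [le_div_iff₀ hρpos]
        nlinarith [sq_nonneg γ]
      have h5 : ((K : ℝ) + 1) * (γ * (1 - γ)) * (1 - 8 * γ ^ 2) ^ (K + 1) / D * S.card ≤
          S.card * (γ * (1 - γ) / D + b / (ρ * D) * (1 - γ - 2 * γ ^ 2)) := by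
        have h6 : γ * (1 - γ) / D + b / (ρ * D) * (1 - γ - 2 * γ ^ 2) =
            (γ * (1 - γ) + b / ρ * (1 - γ - 2 * γ ^ 2)) / D := by
          field_simp
        rw [h6, mul_comm]
        refine mul_le_mul_of_nonneg_left ?_ (Nat.cast_nonneg _)
        exact div_le_div_of_nonneg_right (h1.trans (by linarith)) hDpos.le
      have h7 : b / (ρ * D) * T.card ≤ I.card := hIcard
      linarith

end nibble

-- Choice of parameters and of the error function.

universe u

/-- The lower bound `(1 - ε) n log Δ / Δ` for independence numbers, for all graphs of maximum
degree at most `Δ` and maximum codegree at most `2⁻⁷ Δ (log Δ)⁻⁷`. -/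
def IndepNumBound (Δ ε : ℝ) : Prop :=
  ∀ (V : Type u) [Fintype V] [DecidableEq V] (G : SimpleGraph V) [DecidableRel G.Adj],
    (G.maxDegree : ℝ) ≤ Δ →
    (G.maxCodegree : ℝ) ≤ (2 : ℝ) ^ (-7 : ℤ) * Δ * Real.log Δ ^ (-7 : ℤ) →
    (1 - ε) * ((Fintype.card V : ℝ) * Real.log Δ / Δ) ≤ (G.indepNum : ℝ)

lemma indepNumBound_one (Δ : ℝ) : IndepNumBound.{u} Δ 1 := by
  intro V _ _ G _ _ _
  simp

lemma IndepNumBound.mono {Δ ε ε' : ℝ} (hΔ : 1 < Δ) (h : IndepNumBound.{u} Δ ε) (hε : ε ≤ ε') :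
    IndepNumBound.{u} Δ ε' := by
  intro V _ _ G _ h1 h2
  refine le_trans (mul_le_mul_of_nonneg_right (by linarith) ?_) (h V G h1 h2)
  have := Real.log_pos hΔ
  positivity

lemma SimpleGraph.card_inter_le_maxCodegree {V : Type*} [Fintype V] [DecidableEq V]
    (G : SimpleGraph V) [DecidableRel G.Adj] {u v : V} (huv : u ≠ v) :
    (G.neighborFinset u ∩ G.neighborFinset v).card ≤ G.maxCodegree :=
  Finset.le_sup (f := fun p : V × V => (G.neighborFinset p.1 ∩ G.neighborFinset p.2).card)
    (b := (u, v)) (by simpa using huv)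

/-- The nibble runs from degree bound `Δ` down to about `D₀ = Δ ^ ε`. The assumption `hlarge` says
that `κ ^ 2 * D₀ ≥ 1`; `hL` pays for the accumulated losses. -/
lemma indepNumBound_of_large {Δ ε : ℝ} (hΔ : 1 < Δ) (hε : 0 < ε) (hε1 : ε ≤ 1 / 2)
    (hL : 10 ≤ ε * Real.log Δ)
    (hlarge : 2 ^ 14 * Real.log Δ ^ 14 ≤ Real.exp (ε * Real.log Δ)) :
    IndepNumBound.{u} Δ (2 * ε) := by
  intro V _ _ G _ hmax hcodeg
  have hΔ0 : 0 < Δ := by linarith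
  set L := Real.log Δ with hLdef
  have hL20 : 20 ≤ L := by nlinarith
  have hL0 : 0 < L := by linarith
  have hexpL : Real.exp L = Δ := Real.exp_log hΔ0
  set γ : ℝ := 1 / L ^ 2 with hγ
  set κ : ℝ := 1 / (2 ^ 7 * L ^ 7) with hκ
  set K : ℕ := ⌊(1 - ε) * L ^ 3⌋₊ with hK
  have hγ0 : 0 < γ := by positivity
  have hγL : γ * L ≤ 1 / 20 := by
    rw [hγ, div_mul_eq_mul_div, div_le_div_iff₀ (by positivity) (by norm_num)]
    nlinarith
  have hγ1 : γ ≤ 1 / 400 := by nlinarith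
  have hLpow : ∀ k : ℕ, 1 ≤ L ^ k := fun k => one_le_pow₀ (by linarith)
  have hκD : 1 ≤ κ * (κ * Real.exp (ε * L)) := by
    have : κ * (κ * Real.exp (ε * L)) = Real.exp (ε * L) / (2 ^ 14 * L ^ 14) := by
      rw [hκ]; field_simp
    rw [this, le_div_iff₀ (by positivity), one_mul]
    exact hlarge
  have hγD : 2 ≤ γ * (Real.exp (ε * L) - 1) := by
    rw [hγ, div_mul_eq_mul_div, le_div_iff₀ (by positivity)]
    have h1 : L ^ 2 ≤ L ^ 14 := pow_le_pow_right₀ (by linarith) (by norm_num)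
    have := hLpow 14
    linarith
  have hbad : (1 + Δ ^ 2) * Real.exp (-(γ ^ 3 / (6 * κ))) ≤ γ ^ 2 := by
    -- Here the seventh power of the logarithm enters: the failure exponent becomes linear in `L`,
    -- with a constant large enough to beat `Δ ^ 2`.
    have h1 : γ ^ 3 / (6 * κ) = 64 / 3 * L := by
      rw [hγ, hκ]; field_simp; norm_num
    have h2 : 1 + Δ ^ 2 ≤ 2 * Real.exp (2 * L) := by
      have : Real.exp (2 * L) = Δ ^ 2 := by
        rw [← hexpL, ← Real.exp_nat_mul]; norm_num
      rw [this]
      nlinarith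
    have h3 : 2 * L ^ 4 ≤ Real.exp L := by
      have h4 : Real.exp (ε * L) ≤ Real.exp L := Real.exp_le_exp.2 (by nlinarith)
      have h5 : L ^ 4 ≤ L ^ 14 := pow_le_pow_right₀ (by linarith) (by norm_num)
      have := hLpow 4
      linarith
    rw [h1]
    calc (1 + Δ ^ 2) * Real.exp (-(64 / 3 * L))
        ≤ 2 * Real.exp (2 * L) * Real.exp (-(64 / 3 * L)) :=
          mul_le_mul_of_nonneg_right h2 (Real.exp_pos _).le
      _ = 2 * Real.exp (2 * L + -(64 / 3 * L)) := by rw [Real.exp_add]; ring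
      _ ≤ 2 * Real.exp (-L) := by gcongr; linarith
      _ ≤ γ ^ 2 := by
        rw [hγ, Real.exp_neg, div_pow, one_pow, ← pow_mul, ← div_eq_mul_inv,
          div_le_div_iff₀ (Real.exp_pos _) (by positivity), one_mul]
        exact h3
  have hKle : (K : ℝ) ≤ (1 - ε) * L ^ 3 :=
    Nat.floor_le (mul_nonneg (by linarith) (by positivity))
  have hKge : (1 - ε) * L ^ 3 ≤ K + 1 := (Nat.lt_floor_add_one _).le
  have hγ3 : γ * L ^ 3 = L := by rw [hγ]; field_simp
  have hKγ : γ * K ≤ (1 - ε) * L := by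
    calc γ * K ≤ γ * ((1 - ε) * L ^ 3) := mul_le_mul_of_nonneg_left hKle hγ0.le
      _ = (1 - ε) * (γ * L ^ 3) := by ring
      _ = _ := by rw [hγ3]
  have hKγ' : (1 - ε) * L - γ ≤ γ * K := by
    have h1 := mul_le_mul_of_nonneg_left hKge hγ0.le
    have h2 : γ * ((1 - ε) * L ^ 3) = (1 - ε) * L := by
      rw [mul_left_comm, hγ3]
    linarith
  have hstart : Real.exp (ε * L) * Real.exp (γ * K) ≤ Δ := by
    rw [← Real.exp_add]
    calc Real.exp (ε * L + γ * K) ≤ Real.exp L := Real.exp_le_exp.2 (by linarith)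
      _ = Δ := hexpL
  have hκ1 : κ ≤ 1 := by
    rw [hκ, div_le_one (by positivity)]
    linarith [hLpow 7]
  obtain ⟨I, -, hI, hIcard⟩ := exists_indepSet_of_iterate (G := G) (κ := κ) hγ0 (by linarith)
    (by positivity) hκ1 (Real.exp_pos (ε * L)) hκD hγD hbad K Δ Finset.univ hstart le_rfl
    (fun v _ => by
      rw [Finset.inter_univ, SimpleGraph.card_neighborFinset_eq_degree]
      exact le_trans (by exact_mod_cast G.degree_le_maxDegree v) hmax)
    (fun u _ v _ huv => by
      rw [Finset.inter_univ]
      refine le_trans (Nat.cast_le.2 (G.card_inter_le_maxCodegree huv)) (hcodeg.trans_eq ?_)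
      rw [hκ, zpow_neg, zpow_neg]
      norm_cast
      field_simp)
  have hfac : 1 - 8 * γ * L ≤ (1 - 8 * γ ^ 2) ^ K := by
    have h1 := one_add_mul_le_pow (a := -(8 * γ ^ 2)) (by nlinarith) K
    rw [← sub_eq_add_neg] at h1
    refine le_trans ?_ h1
    have h2 : γ * (γ * K) ≤ γ * L :=
      mul_le_mul_of_nonneg_left (by linarith [mul_pos hε hL0]) hγ0.le
    linarith
  -- Since `γ * L ^ 2 = 1`, the losses beyond `ε * L` total at most `γ + γ * L + 8`, which is below
  -- `10 ≤ ε * L`.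
  have hmain : (1 - 2 * ε) * L ≤ K * (γ * (1 - γ)) * (1 - 8 * γ ^ 2) ^ K := by
    have hγLL : γ * L * L = 1 := by rw [hγ]; field_simp
    have h2 : 1 - γ - 8 * γ * L ≤ (1 - γ) * (1 - 8 * γ ^ 2) ^ K := by
      have := mul_le_mul_of_nonneg_left hfac (by linarith : 0 ≤ 1 - γ)
      have : 0 ≤ γ * (γ * L) := by positivity
      linarith
    have h3 : ((1 - ε) * L - γ) * (1 - γ - 8 * γ * L) ≤
        γ * K * ((1 - γ) * (1 - 8 * γ ^ 2) ^ K) :=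
      mul_le_mul hKγ' h2 (by linarith) (by positivity)
    have h4 : ((1 - ε) * L - γ) * (γ + 8 * γ * L) ≤ L * (γ + 8 * γ * L) :=
      mul_le_mul_of_nonneg_right (by linarith [mul_pos hε hL0]) (by positivity)
    linarith
  calc (1 - 2 * ε) * ((Fintype.card V : ℝ) * L / Δ)
      = (1 - 2 * ε) * L / Δ * (Fintype.card V : ℝ) := by ring
    _ ≤ K * (γ * (1 - γ)) * (1 - 8 * γ ^ 2) ^ K / Δ * (Fintype.card V : ℝ) := by gcongr
    _ ≤ I.card := by simpa using hIcard
    _ ≤ G.indepNum := Nat.cast_le.2 hI.card_le_indepNum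

lemma eventually_indepNumBound {ε : ℝ} (hε : 0 < ε) : ∀ᶠ Δ in atTop, IndepNumBound.{u} Δ ε := by
  set δ := min (ε / 2) (1 / 2) with hδ
  have hδ0 : 0 < δ := by positivity
  have h1 : ∀ᶠ L : ℝ in atTop, 2 ^ 14 * L ^ 14 ≤ Real.exp (δ * L) := by
    have h := (isLittleO_pow_exp_pos_mul_atTop (k := 14) hδ0).def
      (by positivity : (0 : ℝ) < 1 / 2 ^ 14)
    filter_upwards [h] with L hL
    rw [Real.norm_of_nonneg (by positivity), Real.norm_of_nonneg (Real.exp_pos _).le] at hL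
    linarith
  have h2 : ∀ᶠ L : ℝ in atTop, 10 ≤ δ * L :=
    (tendsto_id.const_mul_atTop hδ0).eventually_ge_atTop 10
  filter_upwards [Real.tendsto_log_atTop.eventually h1, Real.tendsto_log_atTop.eventually h2,
    eventually_gt_atTop 1] with Δ hΔ1 hΔ2 hΔ
  exact (indepNumBound_of_large hΔ hδ0 (min_le_right _ _) hΔ2 hΔ1).mono hΔ
    (by linarith [min_le_left (ε / 2) (1 / 2)])

theorem mainTheorem4 :
    ∃ e : ℝ → ℝ, Tendsto e atTop (𝓝 0) ∧
      ∀ Δ : ℝ, 1 < Δ →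
        ∀ (V : Type*) [Fintype V] [DecidableEq V] (G : SimpleGraph V) [DecidableRel G.Adj],
          (G.maxDegree : ℝ) ≤ Δ →
          (G.maxCodegree : ℝ) ≤ (2 : ℝ) ^ (-7 : ℤ) * Δ * Real.log Δ ^ (-7 : ℤ) →
          (1 - e Δ) * ((Fintype.card V : ℝ) * Real.log Δ / Δ) ≤ (G.indepNum : ℝ) := by
  -- The best admissible error at `Δ` is an infimum over bounds uniform in the graph; `ε = 1` is
  -- always admissible. Adding `Δ⁻¹` avoids having to show that the infimum is attained.
  let s : ℝ → Set ℝ := fun Δ => {ε | 0 ≤ ε ∧ IndepNumBound Δ ε}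
  have hbdd : ∀ Δ, BddBelow (s Δ) := fun Δ => ⟨0, fun ε hε => hε.1⟩
  have hne : ∀ Δ, (s Δ).Nonempty := fun Δ => ⟨1, zero_le_one, indepNumBound_one Δ⟩
  refine ⟨fun Δ => sInf (s Δ) + Δ⁻¹, ?_, fun Δ hΔ => ?_⟩
  · have h0 : Tendsto (fun Δ => sInf (s Δ)) atTop (𝓝 0) := by
      rw [tendsto_order]
      refine ⟨fun a ha => Eventually.of_forall fun Δ =>
        ha.trans_le (Real.sInf_nonneg fun ε hε => hε.1), fun a ha => ?_⟩
      filter_upwards [eventually_indepNumBound (half_pos ha)] with Δ h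
      exact (csInf_le (hbdd Δ) ⟨(half_pos ha).le, h⟩).trans_lt (half_lt_self ha)
    simpa using h0.add tendsto_inv_atTop_zero
  · have hpos : 0 < Δ⁻¹ := by positivity
    obtain ⟨ε, hε, hlt⟩ := exists_lt_of_csInf_lt (hne Δ) (lt_add_of_pos_right (sInf (s Δ)) hpos)
    exact hε.2.mono hΔ hlt.le
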